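/- **Setting.** Let $m\in\mathbb N$, $a>0$, and let $H$ be an $m$-variate distribution whose coordinates have finite, strictly positive variances, with marginals $H_1,\dots,H_m$ and correlation matrix $R$. Let $\Phi$ be the standard normal cdf, $\Phi^{-1}(u)=\inf\{t\in\mathbb R:\Phi(t)\ge u\}\in[-\infty,\infty]$, let $\Phi_R$ be the cdf of the $m$-variate normal distribution with mean $0$ and covariance matrix $R$, and let $$C_R(u_1,\dots,u_m)=\Phi_R\big(\Phi^{-1}(u_1),\dots,\Phi^{-1}(u_m)\big),\qquad u\in[0,1]^m,$$ be the Gaussian copula. A random probability measure $P$ is a Dirichlet process, $P\sim DP(a,H_0)$, if for every finite measurable partition $A_1,\dots,A_k$ ($k\ge 2$) the vector $(P(A_1),\dots,P(A_k))$ has the Dirichlet distribution with parameters $aH_0(A_1),\dots,aH_0(A_k)$ (a coordinate with parameter $0$ being a.s. $0$). For each $i=1,\dots,m$ let $P_i\sim DP(a,H_i)$, on a common probability space, be given by its series representation: almost surely $$P_i=\sum_{k\ge1}\frac{L^{-1}(\Gamma^{(i)}_k)}{\sum_{j\ge1}L^{-1}(\Gamma^{(i)}_j)}\,\delta_{Y^{(i)}_k},\qquad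 \Gamma^{(i)}_k=E^{(i)}_1+\dots+E^{(i)}_k,$$ where $(E^{(i)}_k)_k$ are i.i.d. exponential$(1)$, $(Y^{(i)}_k)_k$ are i.i.d. with law $H_i$ and independent of $(E^{(i)}_k)_k$, $L(x)=a\int_x^\infty t^{-1}e^{-t}\,dt$ for $x>0$, and $L^{-1}(y)=\inf\{x>0: L(x)\le y\}$. (No assumption is made on the joint law for different $i$.) Let $$P_{N,i}=\sum_{k=1}^N J^{(i)}_{k,N}\,\delta_{Y^{(i)}_k},\qquad J^{(i)}_{k,N}=\frac{G_{a/N}^{-1}\big(\Gamma^{(i)}_k/\Gamma^{(i)}_{N+1}\big)}{\sum_{j=1}^N G_{a/N}^{-1}\big(\Gamma^{(i)}_j/\Gamma^{(i)}_{N+1}\big)}$$ be its finite approximation, built from the same $\Gamma^{(i)}_k$ and $Y^{(i)}_k$, where $G_{a/N}$ is the complementary cdf of the gamma$(a/N,1)$ distribution and $G_{a/N}^{-1}(p)=\inf\{x>0:G_{a/N}(x)\le p\}$ is its $(1-p)$-quantile. Write $F_i(t)=P_i((-\infty,t])$ and $F_{Ni}(t)=P_{N,i}((-\infty,t])$. **Claim.**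 For every $(t_1,\dots,t_m)\in\mathbb R^m$, almost surely, $$C_R\big(F_{N1}(t_1),\dots,F_{Nm}(t_m)\big)\longrightarrow C_R\big(F_1(t_1),\dots,F_m(t_m)\big)\qquad\text{as }N\to\infty .$$ -/

import Mathlib

open MeasureTheory ProbabilityTheory Filter Topology Set

noncomputable section

namespace DPCopula

/-! ### Gaussian copula -/

/-- The quantile function `Φ⁻¹(u) = inf {t ∈ ℝ | u ≤ Φ(t)}` of the standard normal distribution,
with values in the extended reals, so that `Φ⁻¹(0) = -∞` and `Φ⁻¹(1) = +∞`. -/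
def stdNormalQuantile (u : ℝ) : EReal :=
  sInf ((fun t : ℝ => (t : EReal)) '' {t : ℝ | u ≤ cdf (gaussianReal 0 1) t})

/-- The joint cdf `Φ_R` of the centred `m`-variate normal distribution with covariance
matrix `R`, evaluated at a point of `[-∞, ∞]ᵐ`. -/
def normalCDF {m : ℕ} (R : Matrix (Fin m) (Fin m) ℝ) (q : Fin m → EReal) : ℝ :=
  (multivariateGaussian 0 R).real {x | ∀ i, (x i : EReal) ≤ q i}

/-- The Gaussian copula `C_R(u) = Φ_R(Φ⁻¹(u₁), …, Φ⁻¹(uₘ))`. -/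
def gaussianCopula {m : ℕ} (R : Matrix (Fin m) (Fin m) ℝ) (u : Fin m → ℝ) : ℝ :=
  normalCDF R fun i => stdNormalQuantile (u i)

/-- The correlation matrix of a distribution `H` on `ℝᵐ`. -/
def correlationMatrix {m : ℕ} (H : Measure (Fin m → ℝ)) : Matrix (Fin m) (Fin m) ℝ :=
  Matrix.of fun i j => cov[fun x => x i, fun x => x j; H] /
    (√(Var[fun x => x i; H]) * √(Var[fun x => x j; H]))

/-- The `i`-th marginal distribution of a distribution `H` on `ℝᵐ`. -/
def marginal {m : ℕ} (H : Measure (Fin m → ℝ)) (i : Fin m) : Measure ℝ :=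
  H.map fun x => x i

/-! ### Dirichlet process -/

/-- The gamma distribution with shape `α ≥ 0` and rate `1`; shape `0` gives the point mass
at `0`. -/
def gammaLaw (α : ℝ) : Measure ℝ :=
  if α = 0 then Measure.dirac 0 else gammaMeasure α 1

/-- The Dirichlet distribution with parameters `α₁, …, αₖ ≥ 0`, not all zero: the law of
`(Z₁ / S, …, Zₖ / S)` with `Z_j ~ gamma(α_j, 1)` independent and `S = Z₁ + ⋯ + Zₖ`.
A coordinate with parameter `0` is almost surely `0`. -/
def dirichletLaw {k : ℕ} (α : Fin k → ℝ) : Measure (Fin k → ℝ) :=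
  (Measure.pi fun j => gammaLaw (α j)).map fun z j => z j / ∑ l, z l

/-- `P ~ DP(a, H)`: the random probability measure `P` (a Markov kernel from the probability
space `(Ω, μ)`) is a Dirichlet process with concentration parameter `a` and base measure `H`. -/
def IsDirichletProcess {Ω X : Type*} [MeasurableSpace Ω] [MeasurableSpace X]
    (P : Kernel Ω X) (a : ℝ) (H : Measure X) (μ : Measure Ω) : Prop :=
  IsMarkovKernel P ∧
  ∀ (k : ℕ), 2 ≤ k → ∀ A : Fin k → Set X, (∀ j, MeasurableSet (A j)) →
    Pairwise (fun j l => Disjoint (A j) (A l)) → (⋃ j, A j) = univ →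
    HasLaw (fun ω j => (P ω).real (A j)) (dirichletLaw fun j => a * H.real (A j)) μ

/-! ### Series representation and finite approximation -/

/-- The inverse on `(0, ∞)` of a continuous decreasing function `f`:
`f⁻¹(y) = inf {x > 0 | f x ≤ y}`. -/
def decreasingInverse (f : ℝ → ℝ) (y : ℝ) : ℝ :=
  sInf {x : ℝ | 0 < x ∧ f x ≤ y}

/-- `L(x) = a ∫_x^∞ t⁻¹ e⁻ᵗ dt`. -/
def levyTail (a x : ℝ) : ℝ :=
  a * ∫ t in Ioi x, t⁻¹ * Real.exp (-t)

/-- The complementary cdf `G_α` of the `gamma(α, 1)` distribution. -/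
def gammaTail (α x : ℝ) : ℝ :=
  (gammaMeasure α 1).real (Ioi x)

/-- The partial sum `Γ_k = E₁ + ⋯ + E_k`; sequences are indexed from `0`, so that `E_k` is
`e (k - 1)`. -/
def arrival (e : ℕ → ℝ) (k : ℕ) : ℝ :=
  ∑ j ∈ Finset.range k, e j

/-- The random measure `∑_{i ≥ 1} L⁻¹(Γ_i) δ_{Y_i} / ∑_{j ≥ 1} L⁻¹(Γ_j)`, as a function of the
realizations `e` of `(E_i)` and `y` of `(Y_i)`. -/
def seriesMeasure (a : ℝ) (e y : ℕ → ℝ) : Measure ℝ :=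
  Measure.sum fun i : ℕ =>
    (ENNReal.ofReal (decreasingInverse (levyTail a) (arrival e (i + 1))) /
      ∑' j : ℕ, ENNReal.ofReal (decreasingInverse (levyTail a) (arrival e (j + 1)))) •
    Measure.dirac (y i)

/-- The unnormalized weight `G_{a/N}⁻¹(Γ_i / Γ_{N+1})`. -/
def approxJump (a : ℝ) (N : ℕ) (e : ℕ → ℝ) (i : ℕ) : ℝ :=
  decreasingInverse (gammaTail (a / N)) (arrival e i / arrival e (N + 1))

/-- The finite approximation `P_N = ∑_{i=1}^N J_{i,N} δ_{Y_i}` with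
`J_{i,N} = G_{a/N}⁻¹(Γ_i / Γ_{N+1}) / ∑_{j=1}^N G_{a/N}⁻¹(Γ_j / Γ_{N+1})`. -/
def approxMeasure (a : ℝ) (N : ℕ) (e y : ℕ → ℝ) : Measure ℝ :=
  ∑ i ∈ Finset.range N,
    ENNReal.ofReal
      (approxJump a N e (i + 1) / ∑ j ∈ Finset.range N, approxJump a N e (j + 1)) •
    Measure.dirac (y i)

/-- `E₁, E₂, …` are i.i.d. exponential(1), `Y₁, Y₂, …` are i.i.d. with law `H`, and the two
sequences are independent of each other. -/
structure IsSeriesInput {Ω : Type*} [MeasurableSpace Ω] (H : Measure ℝ)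
    (E Y : ℕ → Ω → ℝ) (μ : Measure Ω) : Prop where
  law_E : ∀ n, HasLaw (E n) (expMeasure 1) μ
  indep_E : iIndepFun E μ
  law_Y : ∀ n, HasLaw (Y n) H μ
  indep_Y : iIndepFun Y μ
  indep_E_Y : IndepFun (fun ω n => E n ω) (fun ω n => Y n ω) μ

end DPCopula

end

namespace DPCopula

/-! The problem splits into a deterministic continuity statement for the copula and a
one-dimensional convergence for each `i`.

Since `R` has unit diagonal, every coordinate of the normal law with covariance `R` is standard
normal. Hence `C_R` is 1-Lipschitz for the ℓ¹ distance on the unit cube, even for singular `R`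
(`gaussianCopula_le_add`). It remains to show `F_{Ni}(t_i) → F_i(t_i)` almost surely for each `i`;
the joint law plays no role.

Write `G_{a/N}⁻¹(Γ_k / Γ_{N+1})` as the inverse of `N G_{a/N}` at `N Γ_k / Γ_{N+1}`. The functions
converge to `L` because `Γ(a/N + 1) → 1` and `t^(a/N - 1) → t⁻¹`, and the levels converge to `Γ_k`
by the strong law. So each jump converges to `L⁻¹(Γ_k)` (`tendsto_approxJump`). A logarithmic bound
on `N G_{a/N}` near `0`, uniform in `N`, dominates the jumps by a geometric sequence
(`exists_summable_bound_approxJump`). Dominated convergence then handles numerator and normaliser,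
and the limiting normaliser is positive. -/

/-! ### Correlation matrices and continuity of the Gaussian copula. -/

lemma posSemidef_correlationMatrix {m : ℕ} (H : Measure (Fin m → ℝ)) [IsProbabilityMeasure H]
    (hH : ∀ i, MemLp (fun x : Fin m → ℝ => x i) 2 H) : (correlationMatrix H).PosSemidef := by
  refine Matrix.PosSemidef.of_dotProduct_mulVec_nonneg ?_ fun v => ?_
  · ext i j
    rw [Matrix.conjTranspose_apply]
    simp only [correlationMatrix, Matrix.of_apply, star_trivial]
    rw [covariance_comm, mul_comm]
  -- The quadratic form at `v` is the variance of `∑ v i / σ i * x i`, with `σ i` the standard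
  -- deviation of the `i`-th coordinate.
  · have hX : ∀ i, MemLp (fun x : Fin m → ℝ =>
        v i / √(Var[fun x : Fin m → ℝ => x i; H]) * x i) 2 H := fun i => (hH i).const_mul _
    have h := variance_fun_sum hX
    have h0 := variance_nonneg (fun x : Fin m → ℝ =>
      ∑ i, v i / √(Var[fun x : Fin m → ℝ => x i; H]) * x i) H
    rw [h] at h0
    refine h0.trans_eq (Eq.symm ?_)
    simp only [dotProduct, Matrix.mulVec, Finset.mul_sum, correlationMatrix, Matrix.of_apply,
      star_trivial, covariance_const_mul_left, covariance_const_mul_right]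
    refine Finset.sum_congr rfl fun i _ => Finset.sum_congr rfl fun j _ => ?_
    rw [div_eq_mul_inv, mul_inv]
    ring

lemma correlationMatrix_self {m : ℕ} (H : Measure (Fin m → ℝ)) (i : Fin m)
    (hvar : 0 < Var[fun x : Fin m → ℝ => x i; H]) : correlationMatrix H i i = 1 := by
  have hm : AEMeasurable (fun x : Fin m → ℝ => x i) H := (measurable_pi_apply i).aemeasurable
  simp only [correlationMatrix, Matrix.of_apply, covariance_self hm]
  rw [Real.mul_self_sqrt hvar.le, div_self hvar.ne']

lemma measurableSet_coe_le (q : EReal) : MeasurableSet {x : ℝ | (x : EReal) ≤ q} :=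
  measurableSet_le measurable_coe_real_ereal measurable_const

/-- The set of points below the `u`-quantile has mass `u`. -/
lemma gaussianReal_le_stdNormalQuantile {u : ℝ} (hu : u ∈ Icc (0 : ℝ) 1) :
    (gaussianReal 0 1).real {x | (x : EReal) ≤ stdNormalQuantile u} = u := by
  set S : Set ℝ := {t : ℝ | u ≤ cdf (gaussianReal 0 1) t} with hS
  have : NullSingletonClass (gaussianReal 0 1) := nullSingletonClass_gaussianReal one_ne_zero
  have hq : stdNormalQuantile u = sInf ((fun t : ℝ => (t : EReal)) '' S) := rfl
  have hup : ∀ t ∈ S, ∀ t', t ≤ t' → t' ∈ S := fun t ht t' h =>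
    le_trans (show u ≤ _ from ht) (monotone_cdf _ h)
  rcases S.eq_empty_or_nonempty with hE | hne
  -- No real reaches level `u`: this forces `u = 1`, and the quantile is `sInf ∅ = ⊤`.
  · have h1 : ∀ t, cdf (gaussianReal 0 1) t ≤ u := fun t => by
      by_contra h
      exact (hE ▸ (show t ∈ S from (not_le.1 h).le) : t ∈ (∅ : Set ℝ))
    have : 1 ≤ u := le_of_tendsto (tendsto_cdf_atTop (gaussianReal 0 1)) (.of_forall h1)
    rw [hq, hE]
    simp [le_antisymm hu.2 this]
  by_cases hb : BddBelow S
  · have hq' : stdNormalQuantile u = ((sInf S : ℝ) : EReal) := by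
      rw [hq]
      refine IsGLB.sInf_eq ⟨?_, fun b hbd => ?_⟩
      · rintro _ ⟨t, ht, rfl⟩
        exact EReal.coe_le_coe_iff.2 (csInf_le hb ht)
      · induction b with
        | bot => exact bot_le
        | top =>
          obtain ⟨t, ht⟩ := hne
          exact absurd (hbd ⟨t, ht, rfl⟩) (by simp)
        | coe b =>
          exact EReal.coe_le_coe_iff.2 (le_csInf hne fun t ht =>
            EReal.coe_le_coe_iff.1 (hbd ⟨t, ht, rfl⟩))
    rw [hq']
    simp only [EReal.coe_le_coe_iff]
    change (gaussianReal 0 1).real (Iic (sInf S)) = u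
    apply le_antisymm
    -- The normal law has no atoms, so the mass is the left limit of the cdf, which stays below `u`
    -- left of `sInf S`. The reverse bound is right continuity.
    · rw [measureReal_congr Iio_ae_eq_Iic.symm, measureReal_def, ← measure_cdf (gaussianReal 0 1),
        StieltjesFunction.measure_Iio _ (tendsto_cdf_atBot _), sub_zero]
      refine ENNReal.toReal_le_of_le_ofReal hu.1 (ENNReal.ofReal_le_ofReal ?_)
      refine le_of_tendsto ((monotone_cdf (gaussianReal 0 1)).tendsto_leftLim (sInf S)) ?_
      filter_upwards [self_mem_nhdsWithin] with t ht
      by_contra hlt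
      exact absurd (csInf_le hb (show t ∈ S from (not_le.1 hlt).le)) (not_le.2 ht)
    · rw [← cdf_eq_real]
      refine ge_of_tendsto ((cdf (gaussianReal 0 1)).right_continuous (sInf S)
        |>.tendsto.mono_left (nhdsWithin_mono _ Ioi_subset_Ici_self)) ?_
      filter_upwards [self_mem_nhdsWithin] with t ht
      obtain ⟨s, hs, hst⟩ := exists_lt_of_csInf_lt hne ht
      exact hup s hs t hst.le
  · have hall : ∀ t, t ∈ S := fun t => by
      rw [not_bddBelow_iff] at hb
      obtain ⟨s, hs, hst⟩ := hb t
      exact hup s hs t hst.le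
    have : u ≤ 0 := ge_of_tendsto (tendsto_cdf_atBot (gaussianReal 0 1)) (.of_forall hall)
    have h0 : u = 0 := le_antisymm this hu.1
    have hbot : stdNormalQuantile u = ⊥ := by
      rw [hq, sInf_eq_bot]
      intro b hb
      obtain ⟨t, -, ht⟩ := EReal.lt_iff_exists_real_btwn.1 hb
      exact ⟨t, ⟨t, hall t, rfl⟩, ht⟩
    rw [hbot]
    simp [h0]

/-- The Gaussian copula is Lipschitz on the unit cube. -/
lemma gaussianCopula_le_add {m : ℕ} {R : Matrix (Fin m) (Fin m) ℝ} (hR : R.PosSemidef)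
    (hdiag : ∀ i, R i i = 1) {u v : Fin m → ℝ} (hu : ∀ i, u i ∈ Icc (0 : ℝ) 1)
    (hv : ∀ i, v i ∈ Icc (0 : ℝ) 1) :
    gaussianCopula R u ≤ gaussianCopula R v + ∑ i, |u i - v i| := by
  set γ := multivariateGaussian (0 : EuclideanSpace ℝ (Fin m)) R
  let A : (Fin m → ℝ) → Fin m → Set ℝ := fun w i => {x | (x : EReal) ≤ stdNormalQuantile (w i)}
  have hA : ∀ w i, MeasurableSet (A w i) := fun w i => measurableSet_coe_le _
  have hlaw : ∀ w i, w i ∈ Icc (0 : ℝ) 1 → (gaussianReal 0 1).real (A w i) = w i :=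
    fun w i h => gaussianReal_le_stdNormalQuantile h
  -- The two half-lines are nested, so their difference is either empty or of standard normal mass
  -- `u i - v i`.
  have hdiff : ∀ i, γ.real {x | x i ∈ A u i \ A v i} ≤ |u i - v i| := fun i => by
    have hmp := measurePreserving_eval_multivariateGaussian
      (μ := (0 : EuclideanSpace ℝ (Fin m))) hR (i := i)
    have : γ.real {x | x i ∈ A u i \ A v i} = (gaussianReal 0 1).real (A u i \ A v i) := by
      have h := hmp.measureReal_preimage ((hA u i).diff (hA v i)).nullMeasurableSet
      rw [hdiag i, Real.toNNReal_one] at h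
      exact h
    rw [this]
    rcases le_total (stdNormalQuantile (u i)) (stdNormalQuantile (v i)) with h | h
    · have : A u i \ A v i = ∅ := sdiff_eq_empty.2 fun x hx => le_trans (show _ ≤ _ from hx) h
      simp [this]
    · have hsub : A v i ⊆ A u i := fun x (hx : (x : EReal) ≤ _) => hx.trans h
      rw [measureReal_sdiff hsub (hA v i), hlaw u i (hu i),
        hlaw v i (hv i)]
      exact le_abs_self _
  calc gaussianCopula R u = γ.real {x | ∀ i, x i ∈ A u i} := rfl
    _ ≤ γ.real ({x | ∀ i, x i ∈ A v i} ∪ ⋃ i, {x | x i ∈ A u i \ A v i}) := by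
        refine measureReal_mono fun x hx => ?_
        by_cases h : ∀ i, x i ∈ A v i
        · exact Or.inl h
        · obtain ⟨i, hi⟩ := not_forall.1 h
          exact Or.inr (mem_iUnion.2 ⟨i, hx i, hi⟩)
    _ ≤ γ.real {x | ∀ i, x i ∈ A v i} + γ.real (⋃ i, {x | x i ∈ A u i \ A v i}) :=
        measureReal_union_le _ _
    _ ≤ gaussianCopula R v + ∑ i, |u i - v i| :=
        add_le_add le_rfl ((measureReal_iUnion_fintype_le _).trans
          (Finset.sum_le_sum fun i _ => hdiff i))

/-- The Gaussian copula of a correlation matrix is continuous along sequences in the unit cube. -/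
lemma tendsto_gaussianCopula {m : ℕ} {R : Matrix (Fin m) (Fin m) ℝ} (hR : R.PosSemidef)
    (hdiag : ∀ i, R i i = 1) {u : ℕ → Fin m → ℝ} {v : Fin m → ℝ}
    (hu : ∀ n i, u n i ∈ Icc (0 : ℝ) 1) (hv : ∀ i, v i ∈ Icc (0 : ℝ) 1)
    (h : ∀ i, Tendsto (fun n => u n i) atTop (𝓝 (v i))) :
    Tendsto (fun n => gaussianCopula R (u n)) atTop (𝓝 (gaussianCopula R v)) := by
  have hs : Tendsto (fun n => ∑ i, |u n i - v i|) atTop (𝓝 0) := by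
    have : Tendsto (fun n => ∑ i, |u n i - v i|) atTop (𝓝 (∑ i, |v i - v i|)) :=
      tendsto_finsetSum _ fun i _ => ((h i).sub_const _).abs
    simpa using this
  rw [tendsto_iff_dist_tendsto_zero]
  refine squeeze_zero (fun _ => dist_nonneg) (fun n => ?_) hs
  rw [Real.dist_eq, abs_sub_le_iff]
  have h1 := gaussianCopula_le_add hR hdiag (hu n) hv
  have h2 := gaussianCopula_le_add hR hdiag hv (hu n)
  simp only [abs_sub_comm (v _)] at h2
  constructor <;> linarith

end DPCopula

noncomputable section

namespace DPCopula

/-! ### Incomplete gamma estimates, uniform in the shape `s ∈ [0, 1]`, covering `L` (`s = 0`) and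
`G_{a/N}` together. -/

/-- The upper incomplete gamma function `∫_x^∞ t^(s-1) e⁻ᵗ dt`, including the value `s = 0`. -/
def upperGamma (s x : ℝ) : ℝ :=
  ∫ t in Ioi x, t ^ (s - 1) * Real.exp (-t)

lemma integrableOn_exp_neg_Ioi (x : ℝ) : IntegrableOn (fun t : ℝ => Real.exp (-t)) (Ioi x) := by
  simpa using exp_neg_integrableOn_Ioi x one_pos

lemma rpow_sub_one_le_one {s t : ℝ} (hs : s ≤ 1) (ht : 1 ≤ t) : t ^ (s - 1) ≤ 1 :=
  Real.rpow_le_one_of_one_le_of_nonpos ht (by linarith)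

lemma rpow_sub_one_le_inv {s t : ℝ} (hs : 0 ≤ s) (ht : 0 < t) (ht1 : t ≤ 1) :
    t ^ (s - 1) ≤ t⁻¹ := by
  rw [← Real.rpow_neg_one]
  exact Real.rpow_le_rpow_of_exponent_ge ht ht1 (by linarith)

/-- The majorant is free of `s`, so it gives integrability and also dominates the limit `s → 0`. -/
lemma upperGamma_integrand_le {s x t : ℝ} (hs0 : 0 ≤ s) (hs1 : s ≤ 1) (hx : 0 < x) (ht : x < t) :
    t ^ (s - 1) * Real.exp (-t) ≤ (1 + x⁻¹) * Real.exp (-t) := by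
  refine mul_le_mul_of_nonneg_right ?_ (Real.exp_pos _).le
  have hxi : 0 < x⁻¹ := inv_pos.2 hx
  rcases le_total t 1 with h | h
  · have h1 := rpow_sub_one_le_inv hs0 (hx.trans ht) h
    have h2 : t⁻¹ ≤ x⁻¹ := inv_anti₀ hx ht.le
    linarith
  · linarith [rpow_sub_one_le_one hs1 h]

lemma measurable_upperGamma_integrand (s : ℝ) :
    Measurable fun t : ℝ => t ^ (s - 1) * Real.exp (-t) := by fun_prop

lemma integrableOn_upperGamma {s x : ℝ} (hs0 : 0 ≤ s) (hs1 : s ≤ 1) (hx : 0 < x) :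
    IntegrableOn (fun t : ℝ => t ^ (s - 1) * Real.exp (-t)) (Ioi x) := by
  refine Integrable.mono' ((integrableOn_exp_neg_Ioi x).const_mul (1 + x⁻¹))
    (measurable_upperGamma_integrand s).aestronglyMeasurable ?_
  filter_upwards [ae_restrict_mem measurableSet_Ioi] with t ht
  have ht0 : 0 < t := hx.trans ht
  rw [Real.norm_of_nonneg (by positivity)]
  exact upperGamma_integrand_le hs0 hs1 hx ht

lemma intervalIntegrable_upperGamma {s x y : ℝ} (hs0 : 0 ≤ s) (hs1 : s ≤ 1) (hx : 0 < x)
    (hxy : x ≤ y) :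
    IntervalIntegrable (fun t : ℝ => t ^ (s - 1) * Real.exp (-t)) volume x y := by
  rw [intervalIntegrable_iff_integrableOn_Ioc_of_le hxy]
  exact (integrableOn_upperGamma hs0 hs1 hx).mono_set Ioc_subset_Ioi_self

lemma upperGamma_eq_add {s x y : ℝ} (hs0 : 0 ≤ s) (hs1 : s ≤ 1) (hx : 0 < x) (hxy : x ≤ y) :
    upperGamma s x = (∫ t in x..y, t ^ (s - 1) * Real.exp (-t)) + upperGamma s y :=
  (intervalIntegral.integral_interval_add_Ioi (integrableOn_upperGamma hs0 hs1 hx)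
    (integrableOn_upperGamma hs0 hs1 (hx.trans_le hxy))).symm

lemma upperGamma_strictAntiOn {s : ℝ} (hs0 : 0 ≤ s) (hs1 : s ≤ 1) :
    StrictAntiOn (upperGamma s) (Ioi 0) := fun x hx y _ hxy => by
  rw [upperGamma_eq_add hs0 hs1 hx hxy.le]
  have : 0 < ∫ t in x..y, t ^ (s - 1) * Real.exp (-t) := by
    refine intervalIntegral.intervalIntegral_pos_of_pos_on
      (intervalIntegrable_upperGamma hs0 hs1 hx hxy.le) (fun t ht => ?_) hxy
    have : 0 < t := lt_trans (show 0 < x from hx) ht.1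
    positivity
  linarith

lemma upperGamma_le_exp {s x : ℝ} (hs0 : 0 ≤ s) (hs1 : s ≤ 1) (hx : 1 ≤ x) :
    upperGamma s x ≤ Real.exp (-x) := by
  rw [← integral_exp_neg_Ioi]
  refine setIntegral_mono_on (integrableOn_upperGamma hs0 hs1 (by linarith))
    (integrableOn_exp_neg_Ioi x) measurableSet_Ioi fun t ht => ?_
  exact mul_le_of_le_one_left (Real.exp_pos _).le
    (rpow_sub_one_le_one hs1 (hx.trans (le_of_lt ht)))

/-- Split at `1`: below it the integrand is at most `t⁻¹`, above it the integral is at most `e⁻¹ ≤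
1`. Inverting this logarithm yields the geometric decay of the jumps. -/
lemma upperGamma_le_log {s x : ℝ} (hs0 : 0 ≤ s) (hs1 : s ≤ 1) (hx : 0 < x) (hx1 : x ≤ 1) :
    upperGamma s x ≤ 1 - Real.log x := by
  have h1 : upperGamma s 1 ≤ 1 :=
    (upperGamma_le_exp hs0 hs1 le_rfl).trans (Real.exp_le_one_iff.2 (by norm_num))
  have h2 : ∫ t in x..1, t ^ (s - 1) * Real.exp (-t) ≤ ∫ t in x..1, t⁻¹ := by
    refine intervalIntegral.integral_mono_on hx1
      (intervalIntegrable_upperGamma hs0 hs1 hx hx1) ?_ fun t ht => ?_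
    · exact intervalIntegral.intervalIntegrable_inv
        (fun t ht => ((uIcc_of_le hx1 ▸ ht).1.trans_lt' hx).ne') continuousOn_id
    · have ht0 : 0 < t := hx.trans_le ht.1
      exact (mul_le_of_le_one_right (by positivity)
        (Real.exp_le_one_iff.2 (by linarith))).trans (rpow_sub_one_le_inv hs0 ht0 ht.2)
  rw [integral_inv_of_pos hx one_pos, one_div, Real.log_inv] at h2
  rw [upperGamma_eq_add hs0 hs1 hx hx1]
  linarith

/-- Logarithmic divergence of `L` at `0`; it makes `L⁻¹` strictly positive. -/
lemma le_upperGamma_zero {x : ℝ} (hx : 0 < x) (hx1 : x ≤ 1) :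
    Real.exp (-1) * -Real.log x ≤ upperGamma 0 x := by
  have h1 : 0 ≤ upperGamma 0 1 := setIntegral_nonneg measurableSet_Ioi fun t ht => by
    have : 0 < t := zero_lt_one.trans ht
    positivity
  have h2 : ∫ t in x..1, Real.exp (-1) * t⁻¹ ≤ ∫ t in x..1, t ^ ((0 : ℝ) - 1) * Real.exp (-t) := by
    refine intervalIntegral.integral_mono_on hx1 ?_
      (intervalIntegrable_upperGamma le_rfl zero_le_one hx hx1) fun t ht => ?_
    · exact (intervalIntegral.intervalIntegrable_inv
        (fun t ht => ((uIcc_of_le hx1 ▸ ht).1.trans_lt' hx).ne') continuousOn_id).const_mul _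
    · have ht0 : 0 < t := hx.trans_le ht.1
      rw [zero_sub, Real.rpow_neg_one, mul_comm]
      exact mul_le_mul_of_nonneg_left (Real.exp_le_exp.2 (by linarith [ht.2])) (by positivity)
  rw [intervalIntegral.integral_const_mul, integral_inv_of_pos hx one_pos, one_div,
    Real.log_inv] at h2
  rw [upperGamma_eq_add le_rfl zero_le_one hx hx1]
  linarith

lemma tendsto_upperGamma {ι : Type*} {l : Filter ι} [l.IsCountablyGenerated] {s : ι → ℝ}
    (hs : Tendsto s l (𝓝 0)) (hs0 : ∀ᶠ n in l, 0 ≤ s n) {x : ℝ} (hx : 0 < x) :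
    Tendsto (fun n => upperGamma (s n) x) l (𝓝 (upperGamma 0 x)) := by
  have hs1 : ∀ᶠ n in l, s n ≤ 1 := (hs.eventually (gt_mem_nhds one_pos)).mono fun _ h => le_of_lt h
  refine tendsto_integral_filter_of_dominated_convergence
    (fun t => (1 + x⁻¹) * Real.exp (-t))
    (.of_forall fun n => (measurable_upperGamma_integrand _).aestronglyMeasurable) ?_
    ((integrableOn_exp_neg_Ioi x).const_mul _) ?_
  · filter_upwards [hs0, hs1] with n h0 h1
    filter_upwards [ae_restrict_mem measurableSet_Ioi] with t ht
    have ht0 : 0 < t := hx.trans ht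
    rw [Real.norm_of_nonneg (by positivity)]
    exact upperGamma_integrand_le h0 h1 hx ht
  · filter_upwards [ae_restrict_mem measurableSet_Ioi] with t ht
    have ht0 : 0 < t := hx.trans ht
    exact ((Real.continuous_const_rpow ht0.ne').continuousAt.tendsto.comp
      (hs.sub_const 1)).mul_const _

lemma levyTail_eq (a x : ℝ) : levyTail a x = a * upperGamma 0 x := by
  simp only [levyTail, upperGamma, zero_sub, Real.rpow_neg_one]

lemma gammaTail_eq {α x : ℝ} (hα : 0 < α) (hx : 0 ≤ x) :
    gammaTail α x = (Real.Gamma α)⁻¹ * upperGamma α x := by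
  have h : gammaTail α x = ∫ t in Ioi x, gammaPDFReal α 1 t := by
    rw [gammaTail, gammaMeasure, measureReal_def, withDensity_apply _ measurableSet_Ioi]
    refine (integral_eq_lintegral_of_nonneg_ae ?_ ?_).symm
    · exact ae_of_all _ fun b => gammaPDFReal_nonneg hα one_pos b
    · fun_prop
  rw [h, upperGamma, ← integral_const_mul]
  refine setIntegral_congr_fun measurableSet_Ioi fun t ht => ?_
  have ht0 : 0 ≤ t := hx.trans (le_of_lt ht)
  simp only [gammaPDFReal, if_pos ht0, Real.one_rpow, one_div, one_mul]
  ring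

/-- The functional equation turns `N / Γ(a/N)` into `a / Γ(a/N + 1)`, which tends to `a`. -/
lemma natCast_mul_gammaTail {a x : ℝ} (ha : 0 < a) {N : ℕ} (hN : 0 < N) (hx : 0 ≤ x) :
    N * gammaTail (a / N) x = a / Real.Gamma (a / N + 1) * upperGamma (a / N) x := by
  have hN' : (0 : ℝ) < N := Nat.cast_pos.2 hN
  have hG := Real.Gamma_pos_of_pos (div_pos ha hN')
  rw [gammaTail_eq (div_pos ha hN') hx, Real.Gamma_add_one (div_pos ha hN').ne']
  field_simp

lemma tendsto_const_div_natCast (a : ℝ) : Tendsto (fun N : ℕ => a / N) atTop (𝓝 0) :=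
  tendsto_const_div_atTop_nhds_zero_nat a

lemma tendsto_Gamma_div_add_one (a : ℝ) :
    Tendsto (fun N : ℕ => Real.Gamma (a / N + 1)) atTop (𝓝 1) := by
  have hc : ContinuousAt Real.Gamma 1 := (Real.differentiableAt_Gamma fun n => by
    have : (0 : ℝ) ≤ n := n.cast_nonneg
    linarith).continuousAt
  have h := hc.tendsto.comp (f := fun N : ℕ => a / N + 1) (x := atTop) (by
    simpa using (tendsto_const_div_natCast a).add_const 1)
  rwa [Real.Gamma_one] at h

lemma tendsto_natCast_mul_gammaTail {a x : ℝ} (ha : 0 < a) (hx : 0 < x) :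
    Tendsto (fun N : ℕ => N * gammaTail (a / N) x) atTop (𝓝 (levyTail a x)) := by
  have h : Tendsto (fun N : ℕ => a / Real.Gamma (a / N + 1) * upperGamma (a / N) x) atTop
      (𝓝 (a / 1 * upperGamma 0 x)) :=
    (tendsto_const_nhds.div (tendsto_Gamma_div_add_one a) one_ne_zero).mul
      (tendsto_upperGamma (tendsto_const_div_natCast a) (.of_forall fun N => by positivity) hx)
  rw [div_one, ← levyTail_eq] at h
  refine h.congr' ?_
  filter_upwards [eventually_gt_atTop 0] with N hN
  exact (natCast_mul_gammaTail ha hN hx.le).symm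

lemma levyTail_strictAntiOn {a : ℝ} (ha : 0 < a) : StrictAntiOn (levyTail a) (Ioi 0) := by
  intro x hx y hy hxy
  simp only [levyTail_eq]
  exact mul_lt_mul_of_pos_left (upperGamma_strictAntiOn le_rfl zero_le_one hx hy hxy) ha

lemma gammaTail_antitone {α : ℝ} (hα : 0 < α) : Antitone (gammaTail α) := fun x y h => by
  have := isProbabilityMeasure_gammaMeasure hα one_pos
  exact measureReal_mono (Ioi_subset_Ioi h)

/-- Once `Γ(a/N + 1) > 1/2` the prefactor is at most `2a`. The threshold on `N` does not depend on
`x`. -/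
lemma eventually_natCast_mul_gammaTail_le {a : ℝ} (ha : 0 < a) :
    ∀ᶠ N : ℕ in atTop, ∀ x : ℝ, 0 < x →
      (1 ≤ x → N * gammaTail (a / N) x ≤ 2 * a * Real.exp (-x)) ∧
      (x ≤ 1 → N * gammaTail (a / N) x ≤ 2 * a * (1 - Real.log x)) := by
  filter_upwards [eventually_gt_atTop 0, (tendsto_const_div_natCast a).eventually
      (gt_mem_nhds one_pos), (tendsto_Gamma_div_add_one a).eventually
      (lt_mem_nhds (show (1 / 2 : ℝ) < 1 by norm_num))] with N hN hN1 hG x hx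
  have hs0 : 0 ≤ a / N := by positivity
  have hc : a / Real.Gamma (a / N + 1) ≤ 2 * a := by
    rw [div_le_iff₀ (by linarith)]
    nlinarith
  have hU : 0 ≤ upperGamma (a / N) x := setIntegral_nonneg measurableSet_Ioi fun t ht => by
    have : 0 < t := hx.trans ht
    positivity
  rw [natCast_mul_gammaTail ha hN hx.le]
  refine ⟨fun h => ?_, fun h => ?_⟩
  · exact mul_le_mul hc (upperGamma_le_exp hs0 hN1.le h) hU (by positivity)
  · exact mul_le_mul hc (upperGamma_le_log hs0 hN1.le hx h) hU (by positivity)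

/-! ### Inverses of decreasing functions -/

lemma decreasingInverse_nonneg (f : ℝ → ℝ) (y : ℝ) : 0 ≤ decreasingInverse f y :=
  Real.sInf_nonneg fun _ hx => hx.1.le

lemma decreasingInverse_le {f : ℝ → ℝ} {x y : ℝ} (hx : 0 < x) (h : f x ≤ y) :
    decreasingInverse f y ≤ x :=
  csInf_le ⟨0, fun _ hx => hx.1.le⟩ ⟨hx, h⟩

lemma decreasingInverse_const_mul {c : ℝ} (hc : 0 < c) (f : ℝ → ℝ) (y : ℝ) :
    decreasingInverse (fun x => c * f x) (c * y) = decreasingInverse f y := by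
  simp only [decreasingInverse, mul_le_mul_iff_right₀ hc]

/-- Pointwise convergence of decreasing functions to a strictly decreasing limit implies the
convergence of their inverses. -/
lemma tendsto_decreasingInverse {ι : Type*} {l : Filter ι} {f : ι → ℝ → ℝ} {g : ℝ → ℝ}
    {p : ι → ℝ} {q : ℝ}
    (hf : ∀ᶠ n in l, Antitone (f n)) (hg : StrictAntiOn g (Ioi 0))
    (hfg : ∀ x, 0 < x → Tendsto (fun n => f n x) l (𝓝 (g x))) (hp : Tendsto p l (𝓝 q))
    (hne : ∃ x, 0 < x ∧ g x < q) :
    Tendsto (fun n => decreasingInverse (f n) (p n)) l (𝓝 (decreasingInverse g q)) := by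
  rw [tendsto_order]
  constructor
  · intro z hz
    rcases lt_or_ge z 0 with h0 | h0
    · exact .of_forall fun n => h0.trans_le (decreasingInverse_nonneg _ _)
    obtain ⟨x, hzx, hx⟩ := exists_between hz
    have hx0 : 0 < x := h0.trans_lt hzx
    have hgx : q < g x := by
      by_contra h
      exact absurd (decreasingInverse_le hx0 (not_lt.1 h)) (not_le.2 hx)
    -- The point `w` keeps the set of the infimum nonempty; otherwise `sInf ∅ = 0` would spoil the
    -- lower bound.
    obtain ⟨w, hw0, hw⟩ := hne
    filter_upwards [hf, hp.eventually_lt (hfg x hx0) hgx, (hfg w hw0).eventually_lt hp hw]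
      with n hn h1 h2
    refine hzx.trans_le (le_csInf ⟨w, hw0, h2.le⟩ fun v hv => ?_)
    by_contra h
    exact absurd (hv.2.trans_lt h1) (not_lt.2 (hn (not_le.1 h).le))
  · intro z hz
    obtain ⟨w, hw0, hw⟩ := hne
    obtain ⟨x, ⟨hx0, hx⟩, hxz⟩ := exists_lt_of_csInf_lt
      (s := {x : ℝ | 0 < x ∧ g x ≤ q}) ⟨w, hw0, hw.le⟩ hz
    -- Moving right to `x'` makes `g x' < q` strict, so the inequality passes to `f n`.
    obtain ⟨x', hxx', hx'z⟩ := exists_between hxz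
    have hx'0 := hx0.trans hxx'
    filter_upwards [(hfg x' hx'0).eventually_lt hp ((hg hx0 hx'0 hxx').trans_le hx)] with n h
    exact (decreasingInverse_le hx'0 h.le).trans_lt hx'z

lemma exists_levyTail_lt {a q : ℝ} (ha : 0 < a) (hq : 0 < q) : ∃ x, 0 < x ∧ levyTail a x < q := by
  have h : Tendsto (fun x : ℝ => a * Real.exp (-x)) atTop (𝓝 (a * 0)) :=
    (Real.tendsto_exp_neg_atTop_nhds_zero).const_mul a
  rw [mul_zero] at h
  obtain ⟨x, hx, hx1⟩ := ((h.eventually (gt_mem_nhds hq)).and (eventually_ge_atTop 1)).exists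
  refine ⟨x, by linarith, lt_of_le_of_lt ?_ hx⟩
  rw [levyTail_eq]
  exact mul_le_mul_of_nonneg_left (upperGamma_le_exp le_rfl zero_le_one hx1) ha.le

lemma decreasingInverse_levyTail_pos {a q : ℝ} (ha : 0 < a) (hq : 0 < q) :
    0 < decreasingInverse (levyTail a) q := by
  obtain ⟨w, hw0, hw⟩ := exists_levyTail_lt ha hq
  -- This lower bound solves `a e⁻¹ (-log x) = q`, from `le_upperGamma_zero`.
  refine lt_of_lt_of_le (Real.exp_pos (-(q / (a * Real.exp (-1)))))
    (le_csInf ⟨w, hw0, hw.le⟩ fun x hx => ?_)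
  have hc : 0 < a * Real.exp (-1) := by positivity
  rw [← Real.le_log_iff_exp_le hx.1]
  rcases le_total x 1 with h | h
  · have h1 := mul_le_mul_of_nonneg_left (le_upperGamma_zero hx.1 h) ha.le
    rw [← levyTail_eq] at h1
    rw [neg_le, le_div_iff₀ hc]
    linarith [hx.2]
  · have := Real.log_nonneg h
    have : 0 < q / (a * Real.exp (-1)) := by positivity
    linarith

end DPCopula

end

noncomputable section

namespace DPCopula

/-! ### Arrival times -/

/-- This is the integrand of `Γ(2)`, so the exponential law has mean `Γ(2) = 1`. -/
lemma gammaPDFReal_one_one_mul (x : ℝ) :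
    gammaPDFReal 1 1 x * x =
      (Ioi (0 : ℝ)).indicator (fun x => Real.exp (-x) * x ^ ((2 : ℝ) - 1)) x := by
  have h1 : (2 : ℝ) - 1 = 1 := by norm_num
  rcases lt_trichotomy x 0 with h | rfl | h
  · simp [gammaPDFReal, not_le.2 h, not_lt.2 h.le]
  · simp
  · simp [gammaPDFReal, h.le, h, h1]

lemma integrable_id_expMeasure : Integrable (fun x : ℝ => x) (expMeasure 1) := by
  rw [expMeasure, gammaMeasure,
    integrable_withDensity_iff (f := gammaPDF 1 1) (measurable_gammaPDFReal 1 1).ennreal_ofReal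
      (ae_of_all _ fun _ => ENNReal.ofReal_lt_top)]
  have h := (integrable_indicator_iff measurableSet_Ioi).2
    (Real.GammaIntegral_convergent (s := 2) two_pos)
  refine h.congr (ae_of_all _ fun x => ?_)
  simp only [gammaPDF]
  rw [ENNReal.toReal_ofReal (gammaPDFReal_nonneg one_pos one_pos x), mul_comm,
    gammaPDFReal_one_one_mul]

lemma integral_id_expMeasure : ∫ x : ℝ, x ∂(expMeasure 1) = 1 := by
  rw [expMeasure, gammaMeasure, integral_withDensity_eq_integral_toReal_smul
    (f := gammaPDF 1 1) (measurable_gammaPDFReal 1 1).ennreal_ofReal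
    (ae_of_all _ fun _ => ENNReal.ofReal_lt_top)]
  simp only [gammaPDF, smul_eq_mul,
    ENNReal.toReal_ofReal (gammaPDFReal_nonneg one_pos one_pos _), gammaPDFReal_one_one_mul]
  rw [integral_indicator measurableSet_Ioi, ← Real.Gamma_eq_integral two_pos, Real.Gamma_two]

lemma expMeasure_Iic_zero : expMeasure 1 (Iic 0) = 0 := by
  rw [expMeasure, gammaMeasure, withDensity_apply _ measurableSet_Iic,
    setLIntegral_congr Iio_ae_eq_Iic.symm, lintegral_gammaPDF_of_nonpos le_rfl]

lemma arrival_pos {e : ℕ → ℝ} (he : ∀ n, 0 < e n) {n : ℕ} (hn : 0 < n) : 0 < arrival e n :=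
  Finset.sum_pos (fun i _ => he i) (Finset.nonempty_range_iff.2 hn.ne')

lemma IsSeriesInput.ae_pos {Ω : Type*} [MeasurableSpace Ω] {H : Measure ℝ} {E Y : ℕ → Ω → ℝ}
    {μ : Measure Ω} (h : IsSeriesInput H E Y μ) : ∀ᵐ ω ∂μ, ∀ n, 0 < E n ω := by
  refine ae_all_iff.2 fun n => ?_
  have h1 : ∀ᵐ x ∂(expMeasure 1), 0 < x := by
    rw [ae_iff]
    simpa [Iic_def] using expMeasure_Iic_zero
  rw [← (h.law_E n).map_eq] at h1
  exact ae_of_ae_map (h.law_E n).aemeasurable h1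

lemma IsSeriesInput.ae_tendsto_arrival {Ω : Type*} [MeasurableSpace Ω] {H : Measure ℝ}
    {E Y : ℕ → Ω → ℝ} {μ : Measure Ω} (h : IsSeriesInput H E Y μ) :
    ∀ᵐ ω ∂μ, Tendsto (fun n : ℕ => arrival (fun k => E k ω) n / n) atTop (𝓝 1) := by
  have hmean : μ[E 0] = 1 := by
    rw [(h.law_E 0).integral_eq]
    exact integral_id_expMeasure
  have hint : Integrable (E 0) μ := by
    have h1 := integrable_id_expMeasure
    rw [← (h.law_E 0).map_eq] at h1
    exact h1.comp_aemeasurable (h.law_E 0).aemeasurable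
  have := strong_law_ae_real E hint (fun i j hij => h.indep_E.indepFun hij) fun i =>
    ⟨(h.law_E i).aemeasurable, (h.law_E 0).aemeasurable,
      (h.law_E i).map_eq.trans (h.law_E 0).map_eq.symm⟩
  rwa [hmean] at this

/-- A positive sequence asymptotic to `n` is squeezed between two multiples of `n`. -/
lemma exists_linear_bounds {g : ℕ → ℝ} (hpos : ∀ n, 0 < n → 0 < g n)
    (hlim : Tendsto (fun n : ℕ => g n / n) atTop (𝓝 1)) :
    ∃ c C : ℝ, 0 < c ∧ 0 < C ∧ ∀ n : ℕ, 0 < n → c * n ≤ g n ∧ g n ≤ C * n := by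
  -- Convergent sequences are bounded: this is applied to the ratio and to its inverse. The maxima
  -- with `1` keep the constants positive.
  obtain ⟨C, hC⟩ := hlim.bddAbove_range
  have hinv := hlim.inv₀ one_ne_zero
  obtain ⟨B, hB⟩ := hinv.bddAbove_range
  have hB1 : 0 < max B 1 := by positivity
  refine ⟨(max B 1)⁻¹, max C 1, by positivity, by positivity, fun n hn => ?_⟩
  have hn' : (0 : ℝ) < n := Nat.cast_pos.2 hn
  have h1 : g n / n ≤ max C 1 := (hC ⟨n, rfl⟩).trans (le_max_left _ _)
  have h2 : (g n / n)⁻¹ ≤ max B 1 := (hB ⟨n, rfl⟩).trans (le_max_left _ _)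
  constructor
  · rw [← le_div_iff₀ hn']
    exact inv_le_of_inv_le₀ (div_pos (hpos n hn) hn') h2
  · rwa [← div_le_iff₀ hn']

/-! ### Convergence of the jumps -/

section Jumps

variable {a : ℝ} {e : ℕ → ℝ}

/-- The jumps of the limiting series. -/
def levyJump (a : ℝ) (e : ℕ → ℝ) (k : ℕ) : ℝ :=
  decreasingInverse (levyTail a) (arrival e k)

lemma approxJump_eq {N : ℕ} (hN : 0 < N) (k : ℕ) :
    approxJump a N e k = decreasingInverse (fun x => N * gammaTail (a / N) x)
      (N * (arrival e k / arrival e (N + 1))) :=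
  (decreasingInverse_const_mul (Nat.cast_pos.2 hN) _ _).symm

lemma tendsto_natCast_mul_arrival_div (hlim : Tendsto (fun n : ℕ => arrival e n / n) atTop (𝓝 1))
    (k : ℕ) :
    Tendsto (fun N : ℕ => N * (arrival e k / arrival e (N + 1))) atTop (𝓝 (arrival e k)) := by
  have h1 : Tendsto (fun N : ℕ => arrival e (N + 1) / ((N + 1 : ℕ) : ℝ)) atTop (𝓝 1) :=
    hlim.comp (tendsto_add_atTop_nat 1)
  have h2 : Tendsto (fun N : ℕ => (N : ℝ) / (N + 1)) atTop (𝓝 1) :=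
    tendsto_natCast_div_add_atTop 1
  have h3 := (h2.mul (h1.inv₀ one_ne_zero)).mul_const (arrival e k)
  rw [inv_one, one_mul, one_mul] at h3
  refine h3.congr fun N => ?_
  have : ((N : ℝ) + 1) ≠ 0 := by positivity
  push_cast
  rw [inv_div]
  field_simp

lemma tendsto_approxJump (ha : 0 < a) (he : ∀ n, 0 < e n)
    (hlim : Tendsto (fun n : ℕ => arrival e n / n) atTop (𝓝 1)) {k : ℕ} (hk : 0 < k) :
    Tendsto (fun N => approxJump a N e k) atTop (𝓝 (levyJump a e k)) := by
  have h := tendsto_decreasingInverse (l := atTop) (f := fun (N : ℕ) x => N * gammaTail (a / N) x)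
    (p := fun N : ℕ => N * (arrival e k / arrival e (N + 1)))
    ((eventually_gt_atTop 0).mono fun N hN => (gammaTail_antitone
      (div_pos ha (Nat.cast_pos.2 hN))).const_mul N.cast_nonneg)
    (levyTail_strictAntiOn ha) (fun x hx => tendsto_natCast_mul_gammaTail ha hx)
    (tendsto_natCast_mul_arrival_div hlim k) (exists_levyTail_lt ha (arrival_pos he hk))
  refine h.congr' ?_
  filter_upwards [eventually_gt_atTop 0] with N hN
  exact (approxJump_eq hN k).symm

/-- The jumps of the finite approximations are dominated by a geometric sequence. -/
lemma exists_summable_bound_approxJump (ha : 0 < a) (he : ∀ n, 0 < e n)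
    (hlim : Tendsto (fun n : ℕ => arrival e n / n) atTop (𝓝 1)) :
    ∃ b : ℕ → ℝ, Summable b ∧ ∀ᶠ N : ℕ in atTop, ∀ k, approxJump a N e (k + 1) ≤ b k := by
  obtain ⟨c, C, hc, hC, hcC⟩ := exists_linear_bounds (fun n hn => arrival_pos he hn) hlim
  -- From `Γ_{k+1} ≥ c(k+1)` and `Γ_{N+1} ≤ C(N+1) ≤ 2CN`, the level `N Γ_{k+1} / Γ_{N+1}` is at
  -- least `δ(k+1)`.
  set δ := c / (2 * C) with hδ
  have hδ0 : 0 < δ := by positivity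
  set r := δ / (2 * a) with hr
  have hr0 : 0 < r := by positivity
  obtain ⟨X, hX, hX1⟩ := (((Real.tendsto_exp_neg_atTop_nhds_zero).eventually
    (gt_mem_nhds hr0)).and (eventually_ge_atTop 1)).exists
  refine ⟨fun k => X * Real.exp (1 - r * (k + 1)), ?_, ?_⟩
  · have h : Summable fun k : ℕ => X * Real.exp (1 - r) * Real.exp (-r) ^ k :=
      (summable_geometric_of_lt_one (Real.exp_pos _).le
        (by rw [Real.exp_lt_one_iff]; linarith)).mul_left _
    refine h.congr fun k => ?_
    rw [← Real.exp_nat_mul, mul_assoc, ← Real.exp_add]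
    congr 2
    ring
  · filter_upwards [eventually_gt_atTop 0, eventually_natCast_mul_gammaTail_le ha] with N hN hG k
    have hN1 : (1 : ℝ) ≤ N := by exact_mod_cast hN
    have hk1 : (1 : ℝ) ≤ ((k + 1 : ℕ) : ℝ) := by push_cast; linarith [(k.cast_nonneg : (0 : ℝ) ≤ k)]
    have hp : δ * ((k + 1 : ℕ) : ℝ) ≤ N * (arrival e (k + 1) / arrival e (N + 1)) := by
      have hpos := arrival_pos he N.succ_pos
      have h1 := (hcC (k + 1) k.succ_pos).1
      have h2 : arrival e (N + 1) ≤ 2 * C * N := by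
        refine (hcC (N + 1) N.succ_pos).2.trans ?_
        push_cast
        nlinarith
      have hδc : δ * (2 * C) = c := by rw [hδ]; field_simp
      rw [← mul_div_assoc, le_div_iff₀ hpos]
      calc δ * ((k + 1 : ℕ) : ℝ) * arrival e (N + 1)
          ≤ δ * ((k + 1 : ℕ) : ℝ) * (2 * C * N) := mul_le_mul_of_nonneg_left h2 (by positivity)
        _ = N * (c * ((k + 1 : ℕ) : ℝ)) := by rw [← hδc]; ring
        _ ≤ N * arrival e (k + 1) := mul_le_mul_of_nonneg_left h1 (by positivity)
    have hra : 2 * a * r = δ := by rw [hr]; field_simp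
    rw [approxJump_eq hN]
    rcases le_total 1 (r * ((k + 1 : ℕ) : ℝ)) with h | h
    -- The point `x = exp(1 - r(k+1))` solves `2a(1 - log x) = δ(k+1)`; here `x ≤ 1`, so the
    -- logarithmic bound applies.
    · have hx := decreasingInverse_le (f := fun x => N * gammaTail (a / N) x)
        (y := N * (arrival e (k + 1) / arrival e (N + 1)))
        (Real.exp_pos (1 - r * ((k + 1 : ℕ) : ℝ))) (by
          refine (((hG _ (Real.exp_pos _)).2 (Real.exp_le_one_iff.2 (by linarith))).trans
            (le_of_eq ?_)).trans hp
          rw [Real.log_exp, ← hra]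
          ring)
      refine hx.trans ?_
      push_cast
      exact le_mul_of_one_le_left (Real.exp_pos _).le hX1
    -- For the finitely many small `k` the exponential tail bound at `X` suffices, since `2a e^{-X}
    -- ≤ 2ar = δ`.
    · have hX0 : 0 < X := by linarith
      have hx := decreasingInverse_le (f := fun x => N * gammaTail (a / N) x)
        (y := N * (arrival e (k + 1) / arrival e (N + 1))) hX0 (by
          refine ((hG X hX0).1 hX1).trans (le_trans ?_ hp)
          calc 2 * a * Real.exp (-X) ≤ 2 * a * r :=
                mul_le_mul_of_nonneg_left hX.le (by positivity)
            _ ≤ δ * ((k + 1 : ℕ) : ℝ) := by rw [hra]; exact le_mul_of_one_le_right hδ0.le hk1)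
      refine hx.trans (le_mul_of_one_le_right hX0.le (Real.one_le_exp ?_))
      push_cast at h
      linarith

lemma approxJump_nonneg (a : ℝ) (N : ℕ) (e : ℕ → ℝ) (k : ℕ) : 0 ≤ approxJump a N e k :=
  decreasingInverse_nonneg _ _

lemma levyJump_nonneg (a : ℝ) (e : ℕ → ℝ) (k : ℕ) : 0 ≤ levyJump a e k :=
  decreasingInverse_nonneg _ _

/-- The limiting jumps inherit the summable majorant of the approximating ones. -/
lemma summable_levyJump (ha : 0 < a) (he : ∀ n, 0 < e n)
    (hlim : Tendsto (fun n : ℕ => arrival e n / n) atTop (𝓝 1)) :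
    Summable fun k => levyJump a e (k + 1) := by
  obtain ⟨b, hb, hbound⟩ := exists_summable_bound_approxJump ha he hlim
  refine hb.of_nonneg_of_le (fun k => levyJump_nonneg _ _ _) fun k => ?_
  exact le_of_tendsto (tendsto_approxJump ha he hlim k.succ_pos) (hbound.mono fun N hN => hN k)

/-- Convergence of the weighted sums of the jumps, for weights in `[0, 1]`. -/
lemma tendsto_sum_approxJump_mul (ha : 0 < a) (he : ∀ n, 0 < e n)
    (hlim : Tendsto (fun n : ℕ => arrival e n / n) atTop (𝓝 1)) {w : ℕ → ℝ}
    (hw : ∀ k, w k ∈ Icc (0 : ℝ) 1) :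
    Tendsto (fun N => ∑ k ∈ Finset.range N, approxJump a N e (k + 1) * w k) atTop
      (𝓝 (∑' k, levyJump a e (k + 1) * w k)) := by
  obtain ⟨b, hb, hbound⟩ := exists_summable_bound_approxJump ha he hlim
  -- The finite sums are extended by zero to series; a fixed term is untouched once `N > k`.
  have h := tendsto_tsum_of_dominated_convergence (𝓕 := atTop)
    (f := fun N k => if k ∈ Finset.range N then approxJump a N e (k + 1) * w k else 0)
    (g := fun k => levyJump a e (k + 1) * w k) hb (fun k => ?_) ?_
  · refine h.congr fun N => ?_
    rw [tsum_eq_sum (s := Finset.range N) fun k hk => if_neg hk]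
    exact Finset.sum_congr rfl fun k hk => if_pos hk
  · refine ((tendsto_approxJump ha he hlim k.succ_pos).mul_const (w k)).congr' ?_
    filter_upwards [eventually_gt_atTop k] with N hN
    rw [if_pos (Finset.mem_range.2 hN)]
  · filter_upwards [hbound] with N hN k
    have h0 := approxJump_nonneg a N e (k + 1)
    split_ifs
    · rw [Real.norm_of_nonneg (mul_nonneg h0 (hw k).1)]
      exact (mul_le_of_le_one_right h0 (hw k).2).trans (hN k)
    · simpa using h0.trans (hN k)

end Jumps

/-! ### Convergence of the random measures -/

section Measures

variable {a : ℝ} {e y : ℕ → ℝ} {s : Set ℝ}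

lemma indicator_one_mem_Icc (s : Set ℝ) (x : ℝ) :
    s.indicator (1 : ℝ → ℝ) x ∈ Icc (0 : ℝ) 1 := by
  by_cases h : x ∈ s <;> simp [h]

lemma ofReal_mul_dirac (hs : MeasurableSet s) (c x : ℝ) :
    (ENNReal.ofReal c • Measure.dirac x) s =
      ENNReal.ofReal (c * s.indicator (1 : ℝ → ℝ) x) := by
  by_cases h : x ∈ s <;> simp [hs, h]

lemma approxMeasure_real (N : ℕ) (hs : MeasurableSet s) :
    (approxMeasure a N e y).real s =
      (∑ k ∈ Finset.range N, approxJump a N e (k + 1) * s.indicator (1 : ℝ → ℝ) (y k)) /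
        ∑ k ∈ Finset.range N, approxJump a N e (k + 1) := by
  have hS : 0 ≤ ∑ k ∈ Finset.range N, approxJump a N e (k + 1) :=
    Finset.sum_nonneg fun k _ => approxJump_nonneg _ _ _ _
  have hJ : ∀ k, 0 ≤ approxJump a N e (k + 1) / ∑ k ∈ Finset.range N, approxJump a N e (k + 1) :=
    fun k => div_nonneg (approxJump_nonneg _ _ _ _) hS
  have hJw : ∀ k, 0 ≤ approxJump a N e (k + 1) /
      (∑ k ∈ Finset.range N, approxJump a N e (k + 1)) * s.indicator (1 : ℝ → ℝ) (y k) :=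
    fun k => mul_nonneg (hJ k) (indicator_one_mem_Icc s _).1
  rw [measureReal_def, approxMeasure, Measure.finsetSum_apply]
  simp only [ofReal_mul_dirac hs]
  rw [← ENNReal.ofReal_sum_of_nonneg fun k _ => hJw k,
    ENNReal.toReal_ofReal (Finset.sum_nonneg fun k _ => hJw k), Finset.sum_div]
  exact Finset.sum_congr rfl fun k _ => by ring

/-- Needed for every `N`, as the copula estimate lives on the unit cube; a vanishing normaliser
gives the value `0`. -/
lemma approxMeasure_real_mem_Icc (N : ℕ) (hs : MeasurableSet s) :
    (approxMeasure a N e y).real s ∈ Icc (0 : ℝ) 1 := by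
  refine ⟨measureReal_nonneg, ?_⟩
  rw [approxMeasure_real N hs]
  exact div_le_one_of_le₀ (Finset.sum_le_sum fun k _ =>
    mul_le_of_le_one_right (approxJump_nonneg _ _ _ _) (indicator_one_mem_Icc s _).2)
    (Finset.sum_nonneg fun k _ => approxJump_nonneg _ _ _ _)

lemma tsum_levyJump_pos (ha : 0 < a) (he : ∀ n, 0 < e n)
    (hlim : Tendsto (fun n : ℕ => arrival e n / n) atTop (𝓝 1)) :
    0 < ∑' k, levyJump a e (k + 1) :=
  (summable_levyJump ha he hlim).tsum_pos (fun _ => levyJump_nonneg _ _ _) 0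
    (decreasingInverse_levyTail_pos ha (arrival_pos he one_pos))

lemma seriesMeasure_real (ha : 0 < a) (he : ∀ n, 0 < e n)
    (hlim : Tendsto (fun n : ℕ => arrival e n / n) atTop (𝓝 1)) (hs : MeasurableSet s) :
    (seriesMeasure a e y).real s =
      (∑' k, levyJump a e (k + 1) * s.indicator (1 : ℝ → ℝ) (y k)) /
        ∑' k, levyJump a e (k + 1) := by
  have hsum := summable_levyJump ha he hlim
  have hS := tsum_levyJump_pos ha he hlim
  set S := ∑' k, levyJump a e (k + 1)
  -- Summability makes the extended normaliser finite, so the quotient can be computed in the reals.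
  have hT : ∑' j : ℕ, ENNReal.ofReal (decreasingInverse (levyTail a) (arrival e (j + 1))) =
      ENNReal.ofReal S :=
    (ENNReal.ofReal_tsum_of_nonneg (fun k => levyJump_nonneg a e (k + 1)) hsum).symm
  have hJ : ∀ k, 0 ≤ levyJump a e (k + 1) / S := fun k => div_nonneg (levyJump_nonneg _ _ _) hS.le
  have hJw : ∀ k, 0 ≤ levyJump a e (k + 1) / S * s.indicator (1 : ℝ → ℝ) (y k) :=
    fun k => mul_nonneg (hJ k) (indicator_one_mem_Icc s _).1
  have hsumw : Summable fun k => levyJump a e (k + 1) / S * s.indicator (1 : ℝ → ℝ) (y k) :=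
    (hsum.div_const S).of_nonneg_of_le hJw fun k =>
      mul_le_of_le_one_right (hJ k) (indicator_one_mem_Icc s _).2
  rw [measureReal_def, seriesMeasure, hT, Measure.sum_apply _ hs]
  simp only [← ENNReal.ofReal_div_of_pos hS]
  change (∑' k, (ENNReal.ofReal (levyJump a e (k + 1) / S) • Measure.dirac (y k)) s).toReal = _
  simp only [ofReal_mul_dirac hs]
  rw [← ENNReal.ofReal_tsum_of_nonneg hJw hsumw, ENNReal.toReal_ofReal (tsum_nonneg hJw),
    ← tsum_div_const]
  exact tsum_congr fun k => by ring

lemma tendsto_approxMeasure_real (ha : 0 < a) (he : ∀ n, 0 < e n)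
    (hlim : Tendsto (fun n : ℕ => arrival e n / n) atTop (𝓝 1)) (hs : MeasurableSet s) :
    Tendsto (fun N => (approxMeasure a N e y).real s) atTop
      (𝓝 ((seriesMeasure a e y).real s)) := by
  rw [seriesMeasure_real ha he hlim hs]
  simp only [approxMeasure_real _ hs]
  -- Constant weights give the normaliser; indicator weights give the numerator.
  have h1 := tendsto_sum_approxJump_mul ha he hlim (w := 1) fun k => by simp
  simp only [Pi.one_apply, mul_one] at h1
  exact (tendsto_sum_approxJump_mul ha he hlim fun k => indicator_one_mem_Icc s (y k)).div h1
    (tsum_levyJump_pos ha he hlim).ne'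

end Measures

end DPCopula

end

theorem mainTheorem4 {Ω : Type*} [MeasurableSpace Ω] (μ : Measure Ω) [IsProbabilityMeasure μ]
    (m : ℕ) (a : ℝ) (ha : 0 < a)
    -- the known distribution on `ℝᵐ`, which has a correlation matrix
    (H : Measure (Fin m → ℝ)) [IsProbabilityMeasure H]
    (hH : ∀ i, MemLp (fun x : Fin m → ℝ => x i) 2 H)
    (hvar : ∀ i, 0 < Var[fun x : Fin m → ℝ => x i; H])
    -- the Dirichlet processes, with their series representations
    (P : Fin m → Kernel Ω ℝ)
    (hP : ∀ i, DPCopula.IsDirichletProcess (P i) a (DPCopula.marginal H i) μ)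
    (E Y : Fin m → ℕ → Ω → ℝ)
    (hEY : ∀ i, DPCopula.IsSeriesInput (DPCopula.marginal H i) (E i) (Y i) μ)
    (hseries : ∀ i, ∀ᵐ ω ∂μ,
      P i ω = DPCopula.seriesMeasure a (fun n => E i n ω) (fun n => Y i n ω))
    (t : Fin m → ℝ) :
    ∀ᵐ ω ∂μ, Tendsto
      (fun N : ℕ => DPCopula.gaussianCopula (DPCopula.correlationMatrix H) fun i =>
        (DPCopula.approxMeasure a N (fun n => E i n ω) (fun n => Y i n ω)).real (Iic (t i)))
      atTop
      (𝓝 (DPCopula.gaussianCopula (DPCopula.correlationMatrix H) fun i =>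
        (P i ω).real (Iic (t i)))) := by
  have hpath : ∀ᵐ ω ∂μ, ∀ i, Tendsto
      (fun N : ℕ =>
        (DPCopula.approxMeasure a N (fun n => E i n ω) (fun n => Y i n ω)).real (Iic (t i)))
      atTop (𝓝 ((P i ω).real (Iic (t i)))) := by
    -- Finitely many null sets are discarded, one per coordinate.
    refine ae_all_iff.2 fun i => ?_
    filter_upwards [hseries i, (hEY i).ae_pos, (hEY i).ae_tendsto_arrival] with ω h1 h2 h3
    rw [h1]
    exact DPCopula.tendsto_approxMeasure_real ha h2 h3 measurableSet_Iic
  filter_upwards [hpath] with ω hω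
  refine DPCopula.tendsto_gaussianCopula (DPCopula.posSemidef_correlationMatrix H hH)
    (fun i => DPCopula.correlationMatrix_self H i (hvar i))
    (fun N i => DPCopula.approxMeasure_real_mem_Icc N measurableSet_Iic) (fun i => ?_) hω
  have : IsMarkovKernel (P i) := (hP i).1
  exact ⟨measureReal_nonneg, measureReal_le_one⟩
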